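/- Let $m,n\ge 0$, $d=m+n$, $D=\mathbb{R}_+^m\times\mathbb{R}^n$, and write $x=(x_I,x_J)\in\mathbb{R}^m\times\mathbb{R}^n$ for $x\in\mathbb{R}^d$; for $a,b\in\mathbb{R}^m$, $a\preceq b$ means $a_i\le b_i$ for all $i$. Let $h:\mathbb{R}^d\to\mathbb{R}^d$ be a truncation function (bounded, measurable, $h(\xi)=\xi$ near $0$), and let $(\alpha_i,\beta_i,\mu_i)_{i=0,\dots,d}$ be admissible parameters of a conservative affine process on $D$ in the sense of Duffie, Filipović and Schachermayer, that is, with $\beta_i\in\mathbb{R}^d$: * $\alpha_0,\dots,\alpha_m$ are symmetric positive semidefinite $d\times d$ matrices; $(\alpha_0)_{kl}=0$ for all $k,l\le m$; for $1\le i\le m$, $(\alpha_i)_{kl}=0$ for all $k,l\le m$ with $(k,l)\ne(i,i)$; $\alpha_j=0$ for $j>m$; * $\mu_0,\dots,\mu_m$ are Borel measures on $D\setminus\{0\}$ with $\int\bigl(\sum_{k\le m}(1\wedge|\xi_k|)+\sum_{j>m}(1\wedge|\xi_j|)^2\bigr)\mu_0(\mathrm{d}\xi)<\infty$ and $\int\bigl(\sum_{k\le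 m,\,k\ne i}(1\wedge|\xi_k|)+(1\wedge|\xi_i|)^2+\sum_{j>m}(1\wedge|\xi_j|)^2\bigr)\mu_i(\mathrm{d}\xi)<\infty$ for $1\le i\le m$; $\mu_j=0$ for $j>m$; * $(\beta_0)_k\ge\int h_k\,\mathrm{d}\mu_0$ for $k\le m$; $(\beta_i)_k\ge\int h_k\,\mathrm{d}\mu_i$ for $i,k\le m$ with $k\ne i$; $(\beta_j)_k=0$ for $k\le m<j$. Put $$\mathcal{Y}=\Bigl\{y\in\mathbb{R}^d:\ \sum_{i=0}^m\int_{\{|\xi|\ge1\}}e^{\langle y,\xi\rangle}\mu_i(\mathrm{d}\xi)<\infty\Bigr\}$$ and let $\mathcal{Y}^\circ$ be its interior. For $u\in\mathcal{Y}$ let $F(u)=G_0(u)$ and $R(u)=(G_1(u),\dots,G_d(u))$, where $$G_i(u)=\langle\alpha_iu,u\rangle+\langle\beta_i,u\rangle+\int_{D\setminus\{0\}}\bigl(e^{\langle u,\xi\rangle}-1-\langle u,h(\xi)\rangle\bigr)\mu_i(\mathrm{d}\xi).$$ Fix $\Lambda\in\mathbb{R}^d$. For $(u,v)\in\mathcal{Y}^\circ\times\mathbb{R}$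 let $T_+(u,v)\in[0,\infty]$ be the maximal lifetime of the solution of the generalized Riccati system $$\partial_t\Phi=F(\Psi),\quad\Phi(0)=0,\qquad\partial_t\Psi=R(\Psi)+v\Lambda,\quad\Psi(0)=u,$$ for which $\Psi$ stays in $\mathcal{Y}^\circ$, i.e. the supremum of all $T\ge0$ such that a solution on $[0,T]$ with $\Psi(s)\in\mathcal{Y}^\circ$ for all $s\in[0,T]$ exists. For $t\ge0$ let $$\mathcal{Y}_t=\{(u,v)\in\mathcal{Y}^\circ\times\mathbb{R}:\ T_+(u,v)>t\}.$$ **Lemma.** Let $t\ge0$ and $(u,v)\in\mathcal{Y}_t$. If $(y,z)\in\mathbb{R}^d\times\mathbb{R}$ is such that $y_I\preceq u_I$, $y_J=u_J$ and $z=v$, then $(y,z)\in\mathcal{Y}_t$. -/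

import Mathlib

open MeasureTheory Filter Topology
open scoped NNReal ENNReal Matrix

namespace AffineRiccati

noncomputable section

/-- The space `ℝ^d = ℝ^m × ℝ^n` with its Euclidean norm and inner product. The coordinates
`Sum.inl i` form the block `x_I ∈ ℝ^m`, the coordinates `Sum.inr j` the block `x_J ∈ ℝ^n`. -/
abbrev Vec (m n : ℕ) : Type := EuclideanSpace ℝ (Fin m ⊕ Fin n)

/-- The state space `D = ℝ_+^m × ℝ^n`. -/
def stateSpace (m n : ℕ) : Set (Vec m n) := {x | ∀ i : Fin m, 0 ≤ x (Sum.inl i)}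

/-- A truncation function: bounded, measurable and equal to the identity near the origin. -/
structure IsTruncation {m n : ℕ} (h : Vec m n → Vec m n) : Prop where
  measurable : Measurable h
  bounded : ∃ C : ℝ, ∀ ξ, ‖h ξ‖ ≤ C
  eq_id_near_zero : ∀ᶠ ξ in 𝓝 (0 : Vec m n), h ξ = ξ

/-- A truncation function `h` together with parameters `(α_i, β_i, μ_i)`, `i = 0, 1, …, d`.
The index `0` is kept apart; the indices `1, …, d` are the elements of `Fin m ⊕ Fin n`. -/
structure Params (m n : ℕ) where
  h : Vec m n → Vec m n
  α₀ : Matrix (Fin m ⊕ Fin n) (Fin m ⊕ Fin n) ℝ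
  β₀ : Vec m n
  μ₀ : Measure (Vec m n)
  α : Fin m ⊕ Fin n → Matrix (Fin m ⊕ Fin n) (Fin m ⊕ Fin n) ℝ
  β : Fin m ⊕ Fin n → Vec m n
  μ : Fin m ⊕ Fin n → Measure (Vec m n)

/-- The admissibility conditions of Duffie, Filipović and Schachermayer for a conservative
(no killing) affine process on `ℝ_+^m × ℝ^n`, in the form that they take when the whole vector
`ξ` is truncated by `h` in the Lévy-Khintchine integrals. -/
structure Params.Admissible {m n : ℕ} (p : Params m n) : Prop where
  truncation : IsTruncation p.h
  -- diffusion parameters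
  α₀_psd : p.α₀.PosSemidef
  α₀_II : ∀ k l : Fin m, p.α₀ (Sum.inl k) (Sum.inl l) = 0
  α_psd : ∀ i : Fin m, (p.α (Sum.inl i)).PosSemidef
  α_II : ∀ i k l : Fin m, ¬ (k = i ∧ l = i) → p.α (Sum.inl i) (Sum.inl k) (Sum.inl l) = 0
  α_J : ∀ j : Fin n, p.α (Sum.inr j) = 0
  -- Lévy measures on `D \ {0}`
  μ₀_supp : p.μ₀ (stateSpace m n \ {0})ᶜ = 0
  μ₀_int : ∫⁻ ξ, ENNReal.ofReal
      (∑ k : Fin m, min 1 |ξ (Sum.inl k)| + ∑ j : Fin n, (min 1 |ξ (Sum.inr j)|) ^ 2) ∂p.μ₀ < ∞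
  μ_supp : ∀ i : Fin m, p.μ (Sum.inl i) (stateSpace m n \ {0})ᶜ = 0
  μ_int : ∀ i : Fin m, ∫⁻ ξ, ENNReal.ofReal
      (∑ k : Fin m, (if k = i then (min 1 |ξ (Sum.inl k)|) ^ 2 else min 1 |ξ (Sum.inl k)|)
        + ∑ j : Fin n, (min 1 |ξ (Sum.inr j)|) ^ 2) ∂p.μ (Sum.inl i) < ∞
  μ_J : ∀ j : Fin n, p.μ (Sum.inr j) = 0
  -- drift parameters; the integrals of `h_k` below converge by the conditions above
  β₀_I : ∀ k : Fin m, ∫ ξ, p.h ξ (Sum.inl k) ∂p.μ₀ ≤ p.β₀ (Sum.inl k)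
  β_II : ∀ i k : Fin m, k ≠ i →
      ∫ ξ, p.h ξ (Sum.inl k) ∂p.μ (Sum.inl i) ≤ p.β (Sum.inl i) (Sum.inl k)
  β_JI : ∀ (j : Fin n) (k : Fin m), p.β (Sum.inr j) (Sum.inl k) = 0

/-- `⟨α u, u⟩ + ⟨β, u⟩ + ∫ (e^{⟨u, ξ⟩} - 1 - ⟨u, h(ξ)⟩) μ(dξ)`. -/
def levyKhintchine {m n : ℕ} (h : Vec m n → Vec m n)
    (α : Matrix (Fin m ⊕ Fin n) (Fin m ⊕ Fin n) ℝ) (β : Vec m n) (μ : Measure (Vec m n))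
    (u : Vec m n) : ℝ :=
  (α *ᵥ u.ofLp) ⬝ᵥ u.ofLp + inner ℝ β u
    + ∫ ξ, (Real.exp (inner ℝ u ξ) - 1 - inner ℝ u (h ξ)) ∂μ

/-- The functional characteristic `F`. -/
def Params.F {m n : ℕ} (p : Params m n) (u : Vec m n) : ℝ :=
  levyKhintchine p.h p.α₀ p.β₀ p.μ₀ u

/-- The functional characteristic `R = (R_1, …, R_d)`. -/
def Params.R {m n : ℕ} (p : Params m n) (u : Vec m n) : Vec m n :=
  WithLp.toLp 2 fun i => levyKhintchine p.h (p.α i) (p.β i) (p.μ i) u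

/-- The effective real domain `𝒴` of `F` and `R`. -/
def Params.domain {m n : ℕ} (p : Params m n) : Set (Vec m n) :=
  {y | ∫⁻ ξ in {ξ | 1 ≤ ‖ξ‖}, ENNReal.ofReal (Real.exp (inner ℝ y ξ)) ∂p.μ₀
      + ∑ i : Fin m, ∫⁻ ξ in {ξ | 1 ≤ ‖ξ‖},
          ENNReal.ofReal (Real.exp (inner ℝ y ξ)) ∂p.μ (Sum.inl i) < ∞}

/-- `(Φ, Ψ)` solves `Φ' = F(Ψ)`, `Φ(0) = 0`, `Ψ' = R(Ψ) + v Λ`, `Ψ(0) = u` on `[0, T]`, and `Ψ`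
stays in the interior of `𝒴` on `[0, T]`. -/
structure Params.IsSolution {m n : ℕ} (p : Params m n) (Λ u : Vec m n) (v T : ℝ)
    (Φ : ℝ → ℝ) (Ψ : ℝ → Vec m n) : Prop where
  init_Φ : Φ 0 = 0
  init_Ψ : Ψ 0 = u
  mem_interior : ∀ s ∈ Set.Icc 0 T, Ψ s ∈ interior p.domain
  deriv_Φ : ∀ s ∈ Set.Icc 0 T, HasDerivWithinAt Φ (p.F (Ψ s)) (Set.Icc 0 T) s
  deriv_Ψ : ∀ s ∈ Set.Icc 0 T, HasDerivWithinAt Ψ (p.R (Ψ s) + v • Λ) (Set.Icc 0 T) s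

/-- The maximal lifetime `T_+(u, v) ∈ [0, ∞]` of the solution of the Riccati system started
from `(u, v)` and constrained to stay in the interior of `𝒴`: the supremum of all `T` such that
there is such a solution on `[0, T]`. -/
def Params.lifetime {m n : ℕ} (p : Params m n) (Λ u : Vec m n) (v : ℝ) : ℝ≥0∞ :=
  ⨆ (T : ℝ≥0) (_ : ∃ (Φ : ℝ → ℝ) (Ψ : ℝ → Vec m n), p.IsSolution Λ u v T Φ Ψ), (T : ℝ≥0∞)

/-- The set `𝒴_t` of all `(u, v) ∈ 𝒴° × ℝ` with `T_+(u, v) > t`. -/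
def Params.domainAt {m n : ℕ} (p : Params m n) (Λ : Vec m n) (t : ℝ≥0) : Set (Vec m n × ℝ) :=
  {w | w.1 ∈ interior p.domain ∧ (t : ℝ≥0∞) < p.lifetime Λ w.1 w.2}

end

end AffineRiccati

/-! A solution `Ψ` from `u` on `[0, T]` serves as an upper barrier for the solution from `y`. The
new solution is trapped in the moving boxes between a lower curve `a` and `Ψ`. These boxes form a
compact subset of the interior of `𝒴`, so it can neither blow up nor leave the interior before `T`.

In the `J`-coordinates `R` is linear and sees only `u_J`. These components therefore agree with
those of `Ψ`, and the boxes are flat in those directions. In the `I`-coordinates two facts keep the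
curve inside. By quasi-monotonicity (`levyKhintchine_le_of_le`), lowering the other `I`-coordinates
while `z_i` is fixed does not increase `R_i`; this controls the upper faces. By
`exists_neg_mul_le_levyKhintchine`, `R_i` is bounded below by a negative multiple of `1 + ‖z‖`, so
an exponential `-A e^{κ s}` controls the lower faces. Lowering `I`-coordinates also preserves the
interior of `𝒴`, because `ξ_I ≥ 0` almost everywhere for the Lévy measures.

Existence on all of `[0, T]` comes from `exists_integralCurve_mem_box`: the vector field is composed
with the projection to the box, which makes it bounded and globally Lipschitz, and the resulting
curve is shown never to leave the box. The local Lipschitz property of `R` follows from convexity of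
the Lévy-Khintchine exponents and linearity of the remaining components. -/

/-! ### Scalar comparison and projection to boxes -/

/-- A function that is nonpositive at `0` and cannot increase while it is positive stays
nonpositive. -/
theorem nonpos_of_deriv_nonpos_of_pos {T : ℝ} {f f' : ℝ → ℝ} (h0 : f 0 ≤ 0)
    (hf : ∀ s ∈ Set.Icc 0 T, HasDerivWithinAt f (f' s) (Set.Icc 0 T) s)
    (hf' : ∀ s ∈ Set.Icc 0 T, 0 < f s → f' s ≤ 0) : ∀ s ∈ Set.Icc 0 T, f s ≤ 0 := by
  intro s hs
  -- The barrier `ε * (1 + s)` is positive with slope `ε`. Where `f` touches it, `f` is positive, so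
  -- its slope is at most `0 < ε`.
  have key : ∀ ε > 0, f s ≤ ε * (1 + s) := by
    intro ε hε
    refine image_le_of_deriv_right_lt_deriv_boundary' (f := f) (f' := f') (a := 0) (b := T)
      (B := fun s => ε * (1 + s)) (B' := fun _ => ε)
      (fun r hr => (hf r hr).continuousWithinAt) (fun r hr => ?_) (by linarith) (by fun_prop)
      (fun r hr => ?_) (fun r hr h => ?_) hs
    · exact (hf r (Set.Ico_subset_Icc_self hr)).mono_of_mem_nhdsWithin
        (Icc_mem_nhdsGE_of_mem hr)
    · have := ((hasDerivAt_id r).const_add 1).const_mul ε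
      simpa using this.hasDerivWithinAt
    · refine (hf' r (Set.Ico_subset_Icc_self hr) ?_).trans_lt hε
      rw [h]
      have := hr.1
      positivity
  have hs0 : 0 < 1 + s := by linarith [hs.1]
  refine le_of_forall_pos_le_add fun ε hε => ?_
  have := key (ε / (1 + s)) (by positivity)
  rw [div_mul_cancel₀ _ hs0.ne'] at this
  linarith

/-- Coordinatewise projection to the box between `a` and `b`. -/
noncomputable def clip {ι : Type*} (a b w : EuclideanSpace ℝ ι) : EuclideanSpace ℝ ι :=
  WithLp.toLp 2 fun i => max (a i) (min (w i) (b i))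

section clip

variable {ι : Type*}

@[simp]
theorem clip_apply (a b w : EuclideanSpace ℝ ι) (i : ι) :
    clip a b w i = max (a i) (min (w i) (b i)) := rfl

theorem le_clip (a b w : EuclideanSpace ℝ ι) (i : ι) : a i ≤ clip a b w i := le_max_left _ _

theorem clip_le {a b : EuclideanSpace ℝ ι} (hab : ∀ i, a i ≤ b i) (w : EuclideanSpace ℝ ι)
    (i : ι) : clip a b w i ≤ b i := max_le (hab i) (min_le_right _ _)

theorem clip_of_mem {a b w : EuclideanSpace ℝ ι} (ha : ∀ i, a i ≤ w i) (hb : ∀ i, w i ≤ b i) :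
    clip a b w = w := by
  ext i
  rw [clip_apply, min_eq_left (hb i), max_eq_right (ha i)]

theorem lipschitzWith_clip [Fintype ι] (a b : EuclideanSpace ℝ ι) : LipschitzWith 1 (clip a b) := by
  refine LipschitzWith.of_dist_le_mul fun w z => ?_
  rw [NNReal.coe_one, one_mul, EuclideanSpace.dist_eq, EuclideanSpace.dist_eq]
  gcongr with i
  rw [clip_apply, clip_apply, Real.dist_eq, Real.dist_eq]
  calc |max (a i) (min (w i) (b i)) - max (a i) (min (z i) (b i))|
      ≤ |min (w i) (b i) - min (z i) (b i)| := by
        simpa using abs_max_sub_max_le_max (a i) (min (w i) (b i)) (a i) (min (z i) (b i))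
    _ ≤ |w i - z i| := by
        simpa using abs_min_sub_min_le_max (w i) (b i) (z i) (b i)

end clip

/-! ### Integral curves confined to moving boxes -/

section ODE

variable {ι : Type*} [Fintype ι]

theorem exists_lipschitzOnWith_euclideanSpace {K : Set (EuclideanSpace ℝ ι)}
    {V : EuclideanSpace ℝ ι → EuclideanSpace ℝ ι} (hK : IsCompact K)
    (hV : ∀ i, LocallyLipschitzOn K fun z => V z i) : ∃ C, LipschitzOnWith C V K := by
  choose C hC using fun i => (hV i).exists_lipschitzOnWith_of_compact hK
  have h1 : LipschitzOnWith (∑ i, C i) (fun z => (V z).ofLp) K := by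
    refine LipschitzOnWith.of_dist_le_mul fun x hx y hy => ?_
    refine (dist_pi_le_iff (by positivity)).2 fun i => ((hC i).dist_le_mul x hx y hy).trans ?_
    gcongr
    exact Finset.single_le_sum (f := C) (fun _ _ => zero_le) (Finset.mem_univ i)
  exact ⟨_, ((PiLp.lipschitzWith_toLp 2 fun _ : ι => ℝ).comp_lipschitzOnWith h1)⟩

/-- The box between two continuous curves over a compact time interval is compact. -/
theorem isCompact_iUnion_boxes {T : ℝ} {a b : ℝ → EuclideanSpace ℝ ι}
    (ha : ContinuousOn a (Set.Icc 0 T)) (hb : ContinuousOn b (Set.Icc 0 T)) :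
    IsCompact {z : EuclideanSpace ℝ ι | ∃ s ∈ Set.Icc 0 T, (∀ i, a s i ≤ z i) ∧
      ∀ i, z i ≤ b s i} := by
  obtain ⟨A, hA⟩ := isCompact_Icc.exists_bound_of_continuousOn ha
  obtain ⟨B, hB⟩ := isCompact_Icc.exists_bound_of_continuousOn hb
  -- In space-time the moving boxes form a closed subset `P` of the compact set `S`; forgetting the
  -- time coordinate maps `P` onto the required union.
  set S : Set (ℝ × (ι → ℝ)) := Set.Icc 0 T ×ˢ Set.Icc (fun _ => -A) (fun _ => B) with hS
  have hScomp : IsCompact S := isCompact_Icc.prod isCompact_Icc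
  set P : Set (ℝ × (ι → ℝ)) :=
    S ∩ {q | ∀ i, 0 ≤ q.2 i - a q.1 i ∧ 0 ≤ b q.1 i - q.2 i} with hPdef
  have hP : IsCompact P := by
    refine hScomp.of_isClosed_subset ?_ Set.inter_subset_left
    have ha' : ContinuousOn (fun q : ℝ × (ι → ℝ) => a q.1) S :=
      ha.comp continuousOn_fst fun q hq => hq.1
    have hb' : ContinuousOn (fun q : ℝ × (ι → ℝ) => b q.1) S :=
      hb.comp continuousOn_fst fun q hq => hq.1
    have hcoord : ∀ {f : ℝ × (ι → ℝ) → EuclideanSpace ℝ ι}, ContinuousOn f S → ∀ i,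
        ContinuousOn (fun q => f q i) S := fun h i =>
      (EuclideanSpace.proj (𝕜 := ℝ) i).continuous.comp_continuousOn h
    have hcont : ContinuousOn (fun q : ℝ × (ι → ℝ) =>
        ((fun i => q.2 i - a q.1 i, fun i => b q.1 i - q.2 i) : (ι → ℝ) × (ι → ℝ))) S := by
      refine (continuousOn_pi.2 fun i => ?_).prodMk (continuousOn_pi.2 fun i => ?_)
      · exact ((continuous_apply i).comp continuous_snd).continuousOn.sub (hcoord ha' i)
      · exact (hcoord hb' i).sub ((continuous_apply i).comp continuous_snd).continuousOn
    convert hcont.preimage_isClosed_of_isClosed hScomp.isClosed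
      ((isClosed_Ici (a := (0 : ι → ℝ))).prod (isClosed_Ici (a := (0 : ι → ℝ)))) using 2
    ext q
    exact forall_and
  convert hP.image (f := fun q => WithLp.toLp 2 q.2)
    (by fun_prop) using 1
  ext z
  constructor
  · rintro ⟨s, hs, h1, h2⟩
    refine ⟨(s, z.ofLp), ⟨⟨hs, fun i => ?_, fun i => ?_⟩, fun i => ⟨?_, ?_⟩⟩, rfl⟩
    · have := (abs_le.1 ((PiLp.norm_apply_le (a s) i).trans (hA s hs))).1
      exact this.trans (h1 i)
    · have := (abs_le.1 ((PiLp.norm_apply_le (b s) i).trans (hB s hs))).2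
      exact (h2 i).trans this
    · exact sub_nonneg.2 (h1 i)
    · exact sub_nonneg.2 (h2 i)
  · rintro ⟨⟨s, w⟩, ⟨⟨hs, _⟩, h⟩, rfl⟩
    exact ⟨s, hs, fun i => sub_nonneg.1 (h i).1, fun i => sub_nonneg.1 (h i).2⟩

/-- If a locally Lipschitz vector field `V` points into the boxes between the curves `a` and `b`
along their boundaries, then integral curves that start in the first box exist for all times and
stay inside the boxes. -/
theorem exists_integralCurve_mem_box {T : ℝ} (hT : 0 ≤ T)
    {V : EuclideanSpace ℝ ι → EuclideanSpace ℝ ι} {U : Set (EuclideanSpace ℝ ι)}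
    (hV : ∀ i, LocallyLipschitzOn U fun z => V z i) {a b a' b' : ℝ → EuclideanSpace ℝ ι}
    (ha : ∀ s ∈ Set.Icc 0 T, HasDerivWithinAt a (a' s) (Set.Icc 0 T) s)
    (hb : ∀ s ∈ Set.Icc 0 T, HasDerivWithinAt b (b' s) (Set.Icc 0 T) s)
    (hab : ∀ s ∈ Set.Icc 0 T, ∀ i, a s i ≤ b s i)
    (hU : ∀ s ∈ Set.Icc 0 T, ∀ z, (∀ i, a s i ≤ z i) → (∀ i, z i ≤ b s i) → z ∈ U)
    (hlow : ∀ s ∈ Set.Icc 0 T, ∀ z, (∀ i, a s i ≤ z i) → (∀ i, z i ≤ b s i) →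
      ∀ i, z i = a s i → a' s i ≤ V z i)
    (hup : ∀ s ∈ Set.Icc 0 T, ∀ z, (∀ i, a s i ≤ z i) → (∀ i, z i ≤ b s i) →
      ∀ i, z i = b s i → V z i ≤ b' s i)
    {y : EuclideanSpace ℝ ι} (hya : ∀ i, a 0 i ≤ y i) (hyb : ∀ i, y i ≤ b 0 i) :
    ∃ w : ℝ → EuclideanSpace ℝ ι, w 0 = y ∧ ∀ s ∈ Set.Icc 0 T,
      (∀ i, a s i ≤ w s i) ∧ (∀ i, w s i ≤ b s i) ∧
        HasDerivWithinAt w (V (w s)) (Set.Icc 0 T) s := by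
  have hac : ContinuousOn a (Set.Icc 0 T) := fun s hs => (ha s hs).continuousWithinAt
  have hbc : ContinuousOn b (Set.Icc 0 T) := fun s hs => (hb s hs).continuousWithinAt
  set K := {z : EuclideanSpace ℝ ι | ∃ s ∈ Set.Icc 0 T, (∀ i, a s i ≤ z i) ∧ ∀ i, z i ≤ b s i}
    with hKdef
  have hK : IsCompact K := isCompact_iUnion_boxes hac hbc
  have hKU : K ⊆ U := fun z ⟨s, hs, h1, h2⟩ => hU s hs z h1 h2
  obtain ⟨C, hC⟩ := exists_lipschitzOnWith_euclideanSpace hK fun i => (hV i).mono hKU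
  have hclip : ∀ s ∈ Set.Icc 0 T, ∀ w, clip (a s) (b s) w ∈ K := fun s hs w =>
    ⟨s, hs, le_clip _ _ _, clip_le (hab s hs) w⟩
  obtain ⟨M, hM⟩ := hK.exists_bound_of_continuousOn hC.continuousOn
  -- The clipped field is defined for every `w`, Lipschitz in `w` and bounded by `M`. With a ball of
  -- radius `M * T` the Picard-Lindelöf theorem then covers the whole interval.
  have hP : IsPicardLindelof (fun s w => V (clip (a s) (b s) w)) (tmin := 0) (tmax := T)
      ⟨0, le_rfl, hT⟩ y (M.toNNReal * T.toNNReal) 0 M.toNNReal (C * 1) := by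
    refine ⟨fun s hs => ?_, fun w _ => ?_, fun s hs w _ => ?_, ?_⟩
    · exact hC.comp (lipschitzWith_clip _ _).lipschitzOnWith fun w _ => hclip s hs w
    · refine hC.continuousOn.comp ?_ fun s hs => hclip s hs w
      refine (PiLp.continuous_toLp 2 fun _ : ι => ℝ).comp_continuousOn ?_
      fun_prop
    · exact (hM _ (hclip s hs w)).trans (Real.le_coe_toNNReal M)
    · simp [hT]
  obtain ⟨w, hw0, hw⟩ := hP.exists_eq_forall_mem_Icc_hasDerivWithinAt₀
  have hcoord : ∀ {f : ℝ → EuclideanSpace ℝ ι} {f'} {s : ℝ} (i : ι),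
      HasDerivWithinAt f f' (Set.Icc 0 T) s →
        HasDerivWithinAt (fun s => f s i) (f' i) (Set.Icc 0 T) s := fun {_ _ s} i h =>
    (EuclideanSpace.proj (𝕜 := ℝ) i).hasFDerivAt.comp_hasDerivWithinAt s h
  -- Wherever `w` exceeds `b` in coordinate `i`, the clipped point lies on the upper face `i`. There
  -- `hup` bounds the derivative of `w s i - b s i` by zero. The lower faces are symmetric.
  have hwb : ∀ s ∈ Set.Icc 0 T, ∀ i, w s i ≤ b s i := by
    intro s hs i
    refine sub_nonpos.1 (nonpos_of_deriv_nonpos_of_pos (f := fun s => w s i - b s i)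
      (by simpa [hw0] using hyb i)
      (fun r hr => (hcoord i (hw r hr)).sub (hcoord i (hb r hr))) (fun r hr h => ?_) s hs)
    refine sub_nonpos.2 (hup r hr _ (le_clip _ _ _) (clip_le (hab r hr) _) i ?_)
    rw [clip_apply, min_eq_right (sub_pos.1 h).le, max_eq_right (hab r hr i)]
  have hwa : ∀ s ∈ Set.Icc 0 T, ∀ i, a s i ≤ w s i := by
    intro s hs i
    refine sub_nonpos.1 (nonpos_of_deriv_nonpos_of_pos (f := fun s => a s i - w s i)
      (by simpa [hw0] using hya i)
      (fun r hr => (hcoord i (ha r hr)).sub (hcoord i (hw r hr))) (fun r hr h => ?_) s hs)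
    refine sub_nonpos.2 (hlow r hr _ (le_clip _ _ _) (clip_le (hab r hr) _) i ?_)
    rw [clip_apply, max_eq_left ((min_le_left _ _).trans (sub_pos.1 h).le)]
  refine ⟨w, hw0, fun s hs => ⟨hwa s hs, hwb s hs, ?_⟩⟩
  have := hw s hs
  rwa [clip_of_mem (hwa s hs) (hwb s hs)] at this

end ODE

/-! ### Lévy-Khintchine exponents: integrability, convexity, lower bound, quasi-monotonicity -/

namespace AffineRiccati

variable {m n : ℕ}

/-- The vectors `y` for which `e^{⟨y, ξ⟩}` is `μ`-integrable at infinity. -/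
def expDomain (μ : Measure (Vec m n)) : Set (Vec m n) :=
  {y | IntegrableOn (fun ξ => Real.exp (inner ℝ y ξ)) {ξ | 1 ≤ ‖ξ‖} μ}

theorem IsTruncation.exists_bounds {h : Vec m n → Vec m n} (hh : IsTruncation h) :
    ∃ C ε : ℝ, 0 ≤ C ∧ 0 < ε ∧ ε ≤ 1 ∧ (∀ ξ, ‖h ξ‖ ≤ C) ∧ ∀ ξ, ‖ξ‖ < ε → h ξ = ξ := by
  obtain ⟨C, hC⟩ := hh.bounded
  obtain ⟨δ, hδ, hball⟩ := Metric.eventually_nhds_iff.1 hh.eq_id_near_zero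
  refine ⟨C, min δ 1, (norm_nonneg _).trans (hC 0), lt_min hδ one_pos, min_le_right _ _, hC,
    fun ξ hξ => hball ?_⟩
  rw [dist_zero_right]
  exact hξ.trans_le (min_le_left _ _)

theorem sq_le_min_one_norm_sq {ε : ℝ} (hε : 0 < ε) (hε1 : ε ≤ 1) {ξ : Vec m n} (hξ : ε ≤ ‖ξ‖) :
    ε ^ 2 ≤ min 1 (‖ξ‖ ^ 2) :=
  le_min (pow_le_one₀ hε.le hε1) (pow_le_pow_left₀ hε.le hξ 2)

theorem abs_inner_le_mul {C : ℝ} (u : Vec m n) {η : Vec m n} (hη : ‖η‖ ≤ C) :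
    |inner ℝ u η| ≤ ‖u‖ * C :=
  (abs_real_inner_le_norm u η).trans (by gcongr)

theorem abs_exp_sub_one_sub_id_le_sq_mul_exp (a : ℝ) :
    |Real.exp a - 1 - a| ≤ a ^ 2 * Real.exp |a| := by
  have h := Complex.norm_exp_sub_sum_le_norm_mul_exp (a : ℂ) 2
  have h2 : Complex.exp a - ∑ k ∈ Finset.range 2, (a : ℂ) ^ k / (k.factorial : ℂ)
      = ((Real.exp a - 1 - a : ℝ) : ℂ) := by
    simp [Finset.sum_range_succ]; ring
  rw [h2, Complex.norm_real, Complex.norm_real, Real.norm_eq_abs, Real.norm_eq_abs, sq_abs] at h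
  exact h

/-- The integrand of the Lévy-Khintchine formula is integrable on the exponential domain. -/
theorem integrable_levyKhintchine_integrand {h : Vec m n → Vec m n} (hh : IsTruncation h)
    {μ : Measure (Vec m n)} (hμ : Integrable (fun ξ => min 1 (‖ξ‖ ^ 2)) μ) {u : Vec m n}
    (hu : u ∈ expDomain μ) :
    Integrable (fun ξ => Real.exp (inner ℝ u ξ) - 1 - inner ℝ u (h ξ)) μ := by
  obtain ⟨C, ε, hC0, hε, hε1, hC, hid⟩ := hh.exists_bounds
  have hS : MeasurableSet {ξ : Vec m n | 1 ≤ ‖ξ‖} :=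
    measurableSet_le measurable_const measurable_norm
  have hexp : Integrable ({ξ : Vec m n | 1 ≤ ‖ξ‖}.indicator
      fun ξ => Real.exp (inner ℝ u ξ)) μ := (integrable_indicator_iff hS).2 hu
  -- The first summand handles `‖ξ‖ ≥ ε`, where `min 1 (‖ξ‖ ^ 2) ≥ ε ^ 2`. The second bounds the
  -- Taylor remainder for `‖ξ‖ < ε`, where `h ξ = ξ`.
  set M : ℝ := (Real.exp ‖u‖ + 1 + ‖u‖ * C) / ε ^ 2 + ‖u‖ ^ 2 * Real.exp ‖u‖ with hM
  have hN : 0 ≤ (Real.exp ‖u‖ + 1 + ‖u‖ * C) / ε ^ 2 := by positivity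
  have hmeas : Measurable (fun ξ => Real.exp (inner ℝ u ξ) - 1 - inner ℝ u (h ξ)) := by
    have := hh.measurable
    fun_prop
  refine (hexp.add (hμ.const_mul M)).mono' hmeas.aestronglyMeasurable (ae_of_all _ fun ξ => ?_)
  simp only [Pi.add_apply, Real.norm_eq_abs]
  have hm0 : 0 ≤ min 1 (‖ξ‖ ^ 2) := le_min zero_le_one (sq_nonneg _)
  have hb := abs_le.1 (abs_inner_le_mul u (hC ξ))
  have hfar : ε ≤ ‖ξ‖ →
      Real.exp ‖u‖ + 1 + ‖u‖ * C ≤ M * min 1 (‖ξ‖ ^ 2) := by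
    intro hξ
    calc _ = (Real.exp ‖u‖ + 1 + ‖u‖ * C) / ε ^ 2 * ε ^ 2 := by field_simp
      _ ≤ M * min 1 (‖ξ‖ ^ 2) := by
        gcongr
        · exact le_add_of_nonneg_right (by positivity)
        · exact sq_le_min_one_norm_sq hε hε1 hξ
  have huC : 0 ≤ ‖u‖ * C := by positivity
  have hu1 := Real.exp_pos ‖u‖
  have hx := Real.exp_pos (inner ℝ u ξ)
  by_cases h1 : 1 ≤ ‖ξ‖
  · rw [Set.indicator_of_mem (show ξ ∈ {ξ : Vec m n | 1 ≤ ‖ξ‖} from h1), abs_le]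
    have := hfar (hε1.trans h1)
    constructor <;> linarith
  · rw [Set.indicator_of_notMem (show ξ ∉ {ξ : Vec m n | 1 ≤ ‖ξ‖} from h1), zero_add]
    have h1' : ‖ξ‖ ≤ 1 := (not_le.1 h1).le
    have hin := abs_inner_le_mul u (le_refl ‖ξ‖)
    have hin1 := abs_inner_le_mul u h1'
    rw [mul_one] at hin1
    by_cases h2 : ε ≤ ‖ξ‖
    · have := hfar h2
      have h3 : Real.exp (inner ℝ u ξ) ≤ Real.exp ‖u‖ := Real.exp_le_exp.2 (abs_le.1 hin1).2
      rw [abs_le]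
      constructor <;> linarith
    · rw [hid ξ (not_le.1 h2)]
      refine (abs_exp_sub_one_sub_id_le_sq_mul_exp _).trans ?_
      have hmin : min 1 (‖ξ‖ ^ 2) = ‖ξ‖ ^ 2 := min_eq_right (pow_le_one₀ (norm_nonneg _) h1')
      rw [hmin, ← sq_abs]
      calc |inner ℝ u ξ| ^ 2 * Real.exp |inner ℝ u ξ| ≤ (‖u‖ * ‖ξ‖) ^ 2 * Real.exp ‖u‖ := by
            gcongr
        _ = (‖u‖ ^ 2 * Real.exp ‖u‖) * ‖ξ‖ ^ 2 := by ring
        _ ≤ M * ‖ξ‖ ^ 2 := by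
          gcongr
          exact le_add_of_nonneg_left hN

theorem convex_expDomain (μ : Measure (Vec m n)) : Convex ℝ (expDomain μ) := by
  intro x hx y hy a b ha hb hab
  refine Integrable.mono' ((hx.const_mul a).add (hy.const_mul b))
    (by fun_prop) (ae_of_all _ fun ξ => ?_)
  have := convexOn_exp.2 (Set.mem_univ (inner ℝ x ξ)) (Set.mem_univ (inner ℝ y ξ)) ha hb hab
  simpa [inner_add_left, inner_smul_left] using this

theorem mem_expDomain_of_inner_le {μ : Measure (Vec m n)} {x y : Vec m n} (hx : x ∈ expDomain μ)
    (hle : ∀ᵐ ξ ∂μ, inner ℝ y ξ ≤ inner ℝ x ξ) : y ∈ expDomain μ := by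
  refine Integrable.mono' hx (by fun_prop) ?_
  filter_upwards [ae_restrict_of_ae hle] with ξ hξ
  simpa using hξ

theorem inner_le_inner_of_le {x y ξ : Vec m n} (hξ : ∀ i : Fin m, 0 ≤ ξ (Sum.inl i))
    (hI : ∀ i : Fin m, y (Sum.inl i) ≤ x (Sum.inl i))
    (hJ : ∀ j : Fin n, y (Sum.inr j) = x (Sum.inr j)) : inner ℝ y ξ ≤ inner ℝ x ξ := by
  simp only [PiLp.inner_apply, Fintype.sum_sum_type, hJ, RCLike.inner_apply, conj_trivial]
  gcongr with i
  · exact hξ i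
  · exact hI i

/-- The convexity gap is `a * b` times the form at `x - y`. -/
theorem dotProduct_mulVec_convex {ι : Type*} [Fintype ι] {A : Matrix ι ι ℝ} (hA : A.PosSemidef) :
    ConvexOn ℝ Set.univ fun x : ι → ℝ => (A *ᵥ x) ⬝ᵥ x := by
  refine ⟨convex_univ, fun x _ y _ a b ha hb hab => ?_⟩
  have h0 : 0 ≤ (A *ᵥ (x - y)) ⬝ᵥ (x - y) := by
    have := hA.dotProduct_mulVec_nonneg (x - y)
    rwa [star_trivial, dotProduct_comm] at this
  simp only [Matrix.mulVec_sub, Matrix.mulVec_add, Matrix.mulVec_smul, sub_dotProduct,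
    dotProduct_sub, add_dotProduct, dotProduct_add, smul_dotProduct, dotProduct_smul,
    smul_eq_mul] at h0 ⊢
  obtain rfl : b = 1 - a := by linarith
  nlinarith [mul_nonneg (mul_nonneg ha hb) h0]

/-- Convexity supplies the regularity of these exponents: on an open convex set, a finite convex
function is continuous and locally Lipschitz, so no differentiation under the integral is needed. -/
theorem convexOn_levyKhintchine {h : Vec m n → Vec m n} (hh : IsTruncation h)
    {α : Matrix (Fin m ⊕ Fin n) (Fin m ⊕ Fin n) ℝ} (hα : α.PosSemidef) (β : Vec m n)
    {μ : Measure (Vec m n)} (hμ : Integrable (fun ξ => min 1 (‖ξ‖ ^ 2)) μ) :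
    ConvexOn ℝ (expDomain μ) (levyKhintchine h α β μ) := by
  refine ⟨convex_expDomain μ, fun x hx y hy a b ha hb hab => ?_⟩
  have hquad := (dotProduct_mulVec_convex hα).2 (Set.mem_univ x.ofLp) (Set.mem_univ y.ofLp)
    ha hb hab
  have hix := integrable_levyKhintchine_integrand hh hμ hx
  have hiy := integrable_levyKhintchine_integrand hh hμ hy
  have hixy := integrable_levyKhintchine_integrand hh hμ (convex_expDomain μ hx hy ha hb hab)
  have hint : ∫ ξ, (Real.exp (inner ℝ (a • x + b • y) ξ) - 1 - inner ℝ (a • x + b • y) (h ξ)) ∂μ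
      ≤ a * ∫ ξ, (Real.exp (inner ℝ x ξ) - 1 - inner ℝ x (h ξ)) ∂μ
        + b * ∫ ξ, (Real.exp (inner ℝ y ξ) - 1 - inner ℝ y (h ξ)) ∂μ := by
    rw [← integral_const_mul, ← integral_const_mul,
      ← integral_add (hix.const_mul a) (hiy.const_mul b)]
    refine integral_mono hixy ((hix.const_mul a).add (hiy.const_mul b)) fun ξ => ?_
    have := convexOn_exp.2 (Set.mem_univ (inner ℝ x ξ)) (Set.mem_univ (inner ℝ y ξ)) ha hb hab
    simp only [inner_add_left, inner_smul_left, smul_eq_mul, conj_trivial] at this ⊢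
    obtain rfl : b = 1 - a := by linarith
    linarith
  simp only [levyKhintchine, smul_eq_mul, inner_add_right, inner_smul_right, WithLp.ofLp_add,
    WithLp.ofLp_smul] at hquad ⊢
  linarith

/-- The quadratic part is nonnegative, and so is the integrand near the origin, by `1 + x ≤ e^x`.
Away from the origin the integrand is at least `-(1 + ‖z‖ * C)`, on a set of finite mass. Only
linear growth downwards remains, and an exponential lower barrier can absorb it. -/
theorem exists_neg_mul_le_levyKhintchine {h : Vec m n → Vec m n} (hh : IsTruncation h)
    {α : Matrix (Fin m ⊕ Fin n) (Fin m ⊕ Fin n) ℝ} (hα : α.PosSemidef) (β : Vec m n)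
    {μ : Measure (Vec m n)} (hμ : Integrable (fun ξ => min 1 (‖ξ‖ ^ 2)) μ) :
    ∃ K : ℝ, ∀ z ∈ expDomain μ, -(K * (1 + ‖z‖)) ≤ levyKhintchine h α β μ z := by
  obtain ⟨C, ε, hC0, hε, hε1, hC, hid⟩ := hh.exists_bounds
  obtain ⟨I, hI⟩ : ∃ I : ℝ, I = ∫ ξ, min 1 (‖ξ‖ ^ 2) ∂μ := ⟨_, rfl⟩
  have hI0 : 0 ≤ I := hI ▸ integral_nonneg fun ξ => le_min zero_le_one (sq_nonneg _)
  refine ⟨‖β‖ + (1 + C) / ε ^ 2 * I, fun z hz => ?_⟩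
  have hquad : 0 ≤ (α *ᵥ z.ofLp) ⬝ᵥ z.ofLp := by
    have := hα.dotProduct_mulVec_nonneg z.ofLp
    rwa [star_trivial, dotProduct_comm] at this
  have hlin := (abs_le.1 (abs_real_inner_le_norm β z)).1
  have hint : -((1 + ‖z‖ * C) / ε ^ 2) * I
      ≤ ∫ ξ, (Real.exp (inner ℝ z ξ) - 1 - inner ℝ z (h ξ)) ∂μ := by
    rw [hI, ← integral_const_mul]
    refine integral_mono (hμ.const_mul _) (integrable_levyKhintchine_integrand hh hμ hz)
      fun ξ => ?_
    have hm0 : 0 ≤ min 1 (‖ξ‖ ^ 2) := le_min zero_le_one (sq_nonneg _)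
    have hN : 0 ≤ (1 + ‖z‖ * C) / ε ^ 2 := by positivity
    simp only [neg_mul]
    by_cases h2 : ε ≤ ‖ξ‖
    · have h3 : 1 + ‖z‖ * C ≤ (1 + ‖z‖ * C) / ε ^ 2 * min 1 (‖ξ‖ ^ 2) := by
        calc _ = (1 + ‖z‖ * C) / ε ^ 2 * ε ^ 2 := by field_simp
          _ ≤ _ := by
            gcongr
            exact sq_le_min_one_norm_sq hε hε1 h2
      have hb := abs_le.1 (abs_inner_le_mul z (hC ξ))
      have := Real.exp_pos (inner ℝ z ξ)
      linarith
    · rw [hid ξ (not_le.1 h2)]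
      have := Real.add_one_le_exp (inner ℝ z ξ)
      have := mul_nonneg hN hm0
      linarith
  have hz0 := norm_nonneg z
  have hβ0 := norm_nonneg β
  have hJ0 : 0 ≤ I / ε ^ 2 := div_nonneg hI0 (sq_nonneg ε)
  have e1 : (1 + ‖z‖ * C) / ε ^ 2 * I = (1 + ‖z‖ * C) * (I / ε ^ 2) := by rw [div_mul_eq_mul_div, mul_div_assoc]
  have e2 : (1 + C) / ε ^ 2 * I = (1 + C) * (I / ε ^ 2) := by rw [div_mul_eq_mul_div, mul_div_assoc]
  rw [neg_mul, e1, ← neg_mul] at hint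
  rw [e2]
  simp only [levyKhintchine]
  have hsum : -((‖β‖ + (1 + C) * (I / ε ^ 2)) * (1 + ‖z‖))
      ≤ -(‖β‖ * ‖z‖) + -((1 + ‖z‖ * C) * (I / ε ^ 2)) := by
    generalize I / ε ^ 2 = J at hJ0
    have h1 := mul_nonneg hJ0 hz0
    have h2 := mul_nonneg hJ0 hC0
    linarith
  rw [neg_mul] at hint
  linarith

/-- A coordinate of the truncation function is integrable if that coordinate of `ξ` is
integrable near the origin. -/
theorem IsTruncation.integrable_apply {h : Vec m n → Vec m n} (hh : IsTruncation h)
    {μ : Measure (Vec m n)} (hμ : Integrable (fun ξ => min 1 (‖ξ‖ ^ 2)) μ) {k : Fin m ⊕ Fin n}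
    (hk : Integrable (fun ξ : Vec m n => min 1 |ξ k|) μ) : Integrable (fun ξ => h ξ k) μ := by
  obtain ⟨C, ε, hC0, hε, hε1, hC, hid⟩ := hh.exists_bounds
  have hmeas : Measurable fun ξ => h ξ k := by
    have := hh.measurable
    fun_prop
  refine (hk.add (hμ.const_mul (C / ε ^ 2))).mono' hmeas.aestronglyMeasurable
    (ae_of_all _ fun ξ => ?_)
  simp only [Pi.add_apply]
  have hm0 : 0 ≤ min 1 (‖ξ‖ ^ 2) := le_min zero_le_one (sq_nonneg _)
  by_cases h2 : ε ≤ ‖ξ‖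
  · have h3 : C ≤ C / ε ^ 2 * min 1 (‖ξ‖ ^ 2) := by
      calc C = C / ε ^ 2 * ε ^ 2 := by field_simp
        _ ≤ _ := by
          gcongr
          exact sq_le_min_one_norm_sq hε hε1 h2
    have h4 : 0 ≤ min 1 |ξ k| := le_min zero_le_one (abs_nonneg _)
    have := (PiLp.norm_apply_le (h ξ) k).trans (hC ξ)
    linarith
  · rw [hid ξ (not_le.1 h2)]
    have h4 : |ξ k| ≤ 1 := (PiLp.norm_apply_le ξ k).trans ((not_le.1 h2).le.trans hε1)
    rw [min_eq_right h4, Real.norm_eq_abs]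
    have : 0 ≤ C / ε ^ 2 * min 1 (‖ξ‖ ^ 2) := by positivity
    linarith

/-- Quasi-monotonicity: the Lévy-Khintchine exponent increases in the direction of nonnegative
vectors in the kernel of `α`, supported on coordinates where `h` is integrable and the drift
dominates. -/
theorem levyKhintchine_le_of_le {h : Vec m n → Vec m n} (hh : IsTruncation h)
    {α : Matrix (Fin m ⊕ Fin n) (Fin m ⊕ Fin n) ℝ} (hα : α.PosSemidef) (β : Vec m n)
    {μ : Measure (Vec m n)} (hμ : Integrable (fun ξ => min 1 (‖ξ‖ ^ 2)) μ)
    (hsupp : ∀ᵐ ξ ∂μ, ∀ i : Fin m, 0 ≤ ξ (Sum.inl i)) (i : Fin m)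
    (hαII : ∀ k l : Fin m, ¬ (k = i ∧ l = i) → α (Sum.inl k) (Sum.inl l) = 0)
    (hint : ∀ k : Fin m, k ≠ i → Integrable (fun ξ : Vec m n => min 1 |ξ (Sum.inl k)|) μ)
    (hβ : ∀ k : Fin m, k ≠ i → ∫ ξ, h ξ (Sum.inl k) ∂μ ≤ β (Sum.inl k))
    {x y : Vec m n} (hx : x ∈ expDomain μ)
    (hI : ∀ k : Fin m, y (Sum.inl k) ≤ x (Sum.inl k))
    (hJ : ∀ j : Fin n, y (Sum.inr j) = x (Sum.inr j))
    (hi : y (Sum.inl i) = x (Sum.inl i)) :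
    levyKhintchine h α β μ y ≤ levyKhintchine h α β μ x := by
  have hle : ∀ᵐ ξ ∂μ, inner ℝ y ξ ≤ inner ℝ x ξ := by
    filter_upwards [hsupp] with ξ hξ using inner_le_inner_of_le hξ hI hJ
  have hy : y ∈ expDomain μ := mem_expDomain_of_inner_le hx hle
  set δ : Vec m n := x - y with hδ
  have hδJ : ∀ j, δ (Sum.inr j) = 0 := fun j => by simp [hδ, hJ]
  have hδi : δ (Sum.inl i) = 0 := by simp [hδ, hi]
  have hδ0 : ∀ k, 0 ≤ δ (Sum.inl k) := fun k => by simpa [hδ] using hI k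
  have hxy : x = y + δ := by simp [hδ]
  -- The vector `δ` lives on the coordinates `k ≤ m`, `k ≠ i`, where the block of `α` vanishes.
  -- Hence its quadratic form is zero at `δ`, and semidefiniteness puts `δ` in the kernel.
  have hαδ : α *ᵥ δ.ofLp = 0 := by
    refine (hα.dotProduct_mulVec_zero_iff δ.ofLp).1 ?_
    simp only [dotProduct, Matrix.mulVec, Fintype.sum_sum_type, hδJ, star_trivial, mul_zero,
      zero_mul, Finset.sum_const_zero, add_zero]
    refine Finset.sum_eq_zero fun k _ => ?_
    rw [Finset.sum_eq_zero, mul_zero]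
    intro l _
    by_cases hl : l = i
    · rw [hl, hδi, mul_zero]
    · rw [hαII k l (fun hkl => hl hkl.2), zero_mul]
  have hquad : (α *ᵥ x.ofLp) ⬝ᵥ x.ofLp = (α *ᵥ y.ofLp) ⬝ᵥ y.ofLp := by
    have hsym : (α *ᵥ y.ofLp) ⬝ᵥ δ.ofLp = 0 := by
      have hT : αᵀ = α := by simpa using hα.isHermitian.eq
      rw [dotProduct_comm, Matrix.dotProduct_mulVec, ← Matrix.mulVec_transpose, hT, hαδ,
        zero_dotProduct]
    rw [hxy, WithLp.ofLp_add, Matrix.mulVec_add, hαδ, add_zero, dotProduct_add, hsym, add_zero]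
  have hhk : ∀ k : Fin m, Integrable (fun ξ => δ (Sum.inl k) * h ξ (Sum.inl k)) μ := by
    intro k
    by_cases hk : k = i
    · simp [hk, hδi]
    · exact (hh.integrable_apply hμ (hint k hk)).const_mul _
  have hδh : ∀ η : Vec m n, inner ℝ δ η = ∑ k : Fin m, δ (Sum.inl k) * η (Sum.inl k) := by
    intro η
    simp only [PiLp.inner_apply, Fintype.sum_sum_type, hδJ, RCLike.inner_apply, conj_trivial,
      mul_zero, Finset.sum_const_zero, add_zero]
    exact Finset.sum_congr rfl fun k _ => mul_comm _ _
  have hinth : Integrable (fun ξ => inner ℝ δ (h ξ)) μ := by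
    simp only [hδh]
    exact integrable_finsetSum _ fun k _ => hhk k
  have hdrift : ∫ ξ, inner ℝ δ (h ξ) ∂μ ≤ inner ℝ β δ := by
    rw [real_inner_comm, hδh]
    simp only [hδh]
    rw [integral_finsetSum _ fun k _ => hhk k]
    refine Finset.sum_le_sum fun k _ => ?_
    rw [integral_const_mul]
    by_cases hk : k = i
    · simp [hk, hδi]
    · exact mul_le_mul_of_nonneg_left (hβ k hk) (hδ0 k)
  have hix := integrable_levyKhintchine_integrand hh hμ hx
  have hiy := integrable_levyKhintchine_integrand hh hμ hy
  -- The exponential is monotone along `δ`. The compensators differ by `∫ ⟨δ, h⟩`, which `hdrift`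
  -- lets the drift term absorb.
  have hcmp : ∫ ξ, (Real.exp (inner ℝ y ξ) - 1 - inner ℝ y (h ξ)) ∂μ
      ≤ ∫ ξ, (Real.exp (inner ℝ x ξ) - 1 - inner ℝ x (h ξ)) ∂μ + ∫ ξ, inner ℝ δ (h ξ) ∂μ := by
    rw [← integral_add hix hinth]
    refine integral_mono_ae hiy (hix.add hinth) ?_
    filter_upwards [hle] with ξ hξ
    have h1 := Real.exp_le_exp.2 hξ
    have h2 : inner ℝ x (h ξ) = inner ℝ y (h ξ) + inner ℝ δ (h ξ) := by
      rw [hxy, inner_add_left]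
    linarith
  have hβx : inner ℝ β x = inner ℝ β y + inner ℝ β δ := by rw [hxy, inner_add_right]
  simp only [levyKhintchine]
  linarith

/-! ### Consequences of admissibility for `𝒴`, `F` and `R` -/

variable {p : Params m n}

/-- This turns the coordinatewise admissibility conditions into integrability of `min 1 (‖ξ‖ ^ 2)`.
A coordinate larger than `1` alone contributes `1`; if there is none, the sum is `‖ξ‖ ^ 2`. -/
theorem min_one_norm_sq_le (ξ : Vec m n) :
    min 1 (‖ξ‖ ^ 2) ≤ ∑ k, (min 1 |ξ k|) ^ 2 := by
  by_cases hξ : ∃ k, 1 < |ξ k|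
  · obtain ⟨k, hk⟩ := hξ
    refine (min_le_left _ _).trans ?_
    have := Finset.single_le_sum (f := fun k => (min 1 |ξ k|) ^ 2) (fun _ _ => sq_nonneg _)
      (Finset.mem_univ k)
    simpa [min_eq_left hk.le] using this
  · push Not at hξ
    refine (min_le_right _ _).trans (le_of_eq ?_)
    rw [EuclideanSpace.norm_sq_eq]
    exact Finset.sum_congr rfl fun k _ => by rw [min_eq_right (hξ k), Real.norm_eq_abs]

theorem min_one_abs_sq_le (a : ℝ) : (min 1 |a|) ^ 2 ≤ min 1 |a| :=
  pow_le_of_le_one (le_min zero_le_one (abs_nonneg _)) (min_le_left _ _) two_ne_zero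

theorem integrable_of_le_of_lintegral_lt_top {Ω : Type*} [MeasurableSpace Ω] {μ : Measure Ω}
    {f g : Ω → ℝ} (hf : Measurable f) (hf0 : ∀ ω, 0 ≤ f ω) (hfg : ∀ ω, f ω ≤ g ω)
    (hg : ∫⁻ ω, ENNReal.ofReal (g ω) ∂μ < ∞) : Integrable f μ := by
  refine ⟨hf.aestronglyMeasurable, ?_⟩
  rw [hasFiniteIntegral_iff_ofReal (ae_of_all _ hf0)]
  exact (lintegral_mono fun ω => ENNReal.ofReal_le_ofReal (hfg ω)).trans_lt hg

theorem min_one_abs_nonneg (a : ℝ) : 0 ≤ min 1 |a| := le_min zero_le_one (abs_nonneg _)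

theorem Params.Admissible.integrable_μ₀ (hp : p.Admissible) :
    Integrable (fun ξ => min 1 (‖ξ‖ ^ 2)) p.μ₀ := by
  refine integrable_of_le_of_lintegral_lt_top (by fun_prop)
    (fun ξ => le_min zero_le_one (sq_nonneg _)) (fun ξ => ?_) hp.μ₀_int
  refine (min_one_norm_sq_le ξ).trans ?_
  rw [Fintype.sum_sum_type]
  gcongr with k
  exact min_one_abs_sq_le _

theorem Params.Admissible.integrable_μ (hp : p.Admissible) (i : Fin m) :
    Integrable (fun ξ => min 1 (‖ξ‖ ^ 2)) (p.μ (Sum.inl i)) := by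
  refine integrable_of_le_of_lintegral_lt_top (by fun_prop)
    (fun ξ => le_min zero_le_one (sq_nonneg _)) (fun ξ => ?_) (hp.μ_int i)
  refine (min_one_norm_sq_le ξ).trans ?_
  rw [Fintype.sum_sum_type]
  gcongr with k
  split_ifs
  · exact le_rfl
  · exact min_one_abs_sq_le _

theorem Params.Admissible.integrable_μ_apply (hp : p.Admissible) {i k : Fin m} (hk : k ≠ i) :
    Integrable (fun ξ : Vec m n => min 1 |ξ (Sum.inl k)|) (p.μ (Sum.inl i)) := by
  refine integrable_of_le_of_lintegral_lt_top (by fun_prop)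
    (fun ξ => min_one_abs_nonneg _) (fun ξ => ?_) (hp.μ_int i)
  have h1 := Finset.single_le_sum
    (f := fun k => if k = i then (min 1 |ξ (Sum.inl k)|) ^ 2 else min 1 |ξ (Sum.inl k)|)
    (fun k _ => by
      split_ifs
      · exact sq_nonneg _
      · exact min_one_abs_nonneg _) (Finset.mem_univ k)
  simp only [if_neg hk] at h1
  exact h1.trans (le_add_of_nonneg_right (Finset.sum_nonneg fun _ _ => sq_nonneg _))

theorem ae_nonneg_of_measure_compl_stateSpace {μ : Measure (Vec m n)}
    (hμ : μ (stateSpace m n \ {0})ᶜ = 0) : ∀ᵐ ξ ∂μ, ∀ i : Fin m, 0 ≤ ξ (Sum.inl i) := by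
  filter_upwards [mem_ae_iff.2 hμ] with ξ hξ using hξ.1

theorem mem_expDomain_iff {μ : Measure (Vec m n)} {y : Vec m n} : y ∈ expDomain μ ↔
    ∫⁻ ξ in {ξ | 1 ≤ ‖ξ‖}, ENNReal.ofReal (Real.exp (inner ℝ y ξ)) ∂μ < ∞ := by
  have hm : AEStronglyMeasurable (fun ξ => Real.exp (inner ℝ y ξ))
    (μ.restrict {ξ | 1 ≤ ‖ξ‖}) := by fun_prop
  rw [← hasFiniteIntegral_iff_ofReal (ae_of_all _ fun ξ => (Real.exp_pos _).le)]
  exact ⟨fun h => h.2, fun h => ⟨hm, h⟩⟩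

theorem Params.mem_domain_iff {y : Vec m n} : y ∈ p.domain ↔
    y ∈ expDomain p.μ₀ ∧ ∀ i : Fin m, y ∈ expDomain (p.μ (Sum.inl i)) := by
  simp only [Params.domain, Set.mem_ofPred_eq, ENNReal.add_lt_top, ENNReal.sum_lt_top,
    Finset.mem_univ, forall_true_left, mem_expDomain_iff]

theorem Params.convex_domain (p : Params m n) : Convex ℝ p.domain := by
  intro x hx y hy a b ha hb hab
  rw [Params.mem_domain_iff] at hx hy ⊢
  exact ⟨convex_expDomain _ hx.1 hy.1 ha hb hab,
    fun i => convex_expDomain _ (hx.2 i) (hy.2 i) ha hb hab⟩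

theorem Params.Admissible.mem_domain_of_le (hp : p.Admissible) {x y : Vec m n}
    (hx : x ∈ p.domain) (hI : ∀ i : Fin m, y (Sum.inl i) ≤ x (Sum.inl i))
    (hJ : ∀ j : Fin n, y (Sum.inr j) = x (Sum.inr j)) : y ∈ p.domain := by
  rw [Params.mem_domain_iff] at hx ⊢
  refine ⟨mem_expDomain_of_inner_le hx.1 ?_, fun i => mem_expDomain_of_inner_le (hx.2 i) ?_⟩
  · filter_upwards [ae_nonneg_of_measure_compl_stateSpace hp.μ₀_supp] with ξ hξ
      using inner_le_inner_of_le hξ hI hJ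
  · filter_upwards [ae_nonneg_of_measure_compl_stateSpace (hp.μ_supp i)] with ξ hξ
      using inner_le_inner_of_le hξ hI hJ

theorem Params.Admissible.mem_interior_domain_of_le (hp : p.Admissible) {x y : Vec m n}
    (hx : x ∈ interior p.domain) (hI : ∀ i : Fin m, y (Sum.inl i) ≤ x (Sum.inl i))
    (hJ : ∀ j : Fin n, y (Sum.inr j) = x (Sum.inr j)) : y ∈ interior p.domain := by
  -- The translate of the interior by `y - x` is an open neighbourhood of `y`, and each of its
  -- points lies below its counterpart in the domain.
  refine mem_interior.2 ⟨(fun z => z + (x - y)) ⁻¹' interior p.domain, fun z hz => ?_,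
    isOpen_interior.preimage (by fun_prop), by simpa using hx⟩
  refine hp.mem_domain_of_le (interior_subset hz) (fun i => ?_) fun j => ?_
  · simpa using hI i
  · simp [hJ]

theorem Params.Admissible.R_inr (hp : p.Admissible) (u : Vec m n) (j : Fin n) :
    p.R u (Sum.inr j) = inner ℝ (p.β (Sum.inr j)) u := by
  simp [Params.R, levyKhintchine, hp.α_J, hp.μ_J]

/-- The `J`-components of `R` are linear, and `β_j` has no `I`-part, so the equation for `Ψ_J` is
autonomous. -/
theorem Params.Admissible.R_inr_congr (hp : p.Admissible) {x y : Vec m n}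
    (hJ : ∀ j : Fin n, y (Sum.inr j) = x (Sum.inr j)) (j : Fin n) :
    p.R y (Sum.inr j) = p.R x (Sum.inr j) := by
  simp only [hp.R_inr, PiLp.inner_apply, Fintype.sum_sum_type, hp.β_JI, hJ, inner_zero_left]

theorem Params.Admissible.R_inl_le (hp : p.Admissible) {x y : Vec m n} (hx : x ∈ p.domain)
    (hI : ∀ i : Fin m, y (Sum.inl i) ≤ x (Sum.inl i))
    (hJ : ∀ j : Fin n, y (Sum.inr j) = x (Sum.inr j)) {i : Fin m}
    (hi : y (Sum.inl i) = x (Sum.inl i)) : p.R y (Sum.inl i) ≤ p.R x (Sum.inl i) :=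
  levyKhintchine_le_of_le hp.truncation (hp.α_psd i) _ (hp.integrable_μ i)
    (ae_nonneg_of_measure_compl_stateSpace (hp.μ_supp i)) i (hp.α_II i)
    (fun _ hk => hp.integrable_μ_apply hk) (fun k hk => hp.β_II i k hk)
    ((Params.mem_domain_iff.1 hx).2 i) hI hJ hi

theorem Params.Admissible.locallyLipschitzOn_R (hp : p.Admissible) (i : Fin m ⊕ Fin n) :
    LocallyLipschitzOn (interior p.domain) fun u => p.R u i := by
  cases i with
  | inl i =>
    exact ((convexOn_levyKhintchine hp.truncation (hp.α_psd i) (p.β (Sum.inl i))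
      (hp.integrable_μ i)).subset
        (fun _ hy => (Params.mem_domain_iff.1 (interior_subset hy)).2 i)
        p.convex_domain.interior).locallyLipschitzOn isOpen_interior
  | inr j =>
    simp only [hp.R_inr]
    exact ((innerSL ℝ (p.β (Sum.inr j))).lipschitz.locallyLipschitz).locallyLipschitzOn

theorem Params.Admissible.continuousOn_F (hp : p.Admissible) :
    ContinuousOn p.F (interior p.domain) :=
  ((convexOn_levyKhintchine hp.truncation hp.α₀_psd p.β₀ hp.integrable_μ₀).subset
    (fun _ hy => (Params.mem_domain_iff.1 (interior_subset hy)).1)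
    p.convex_domain.interior).continuousOn isOpen_interior

theorem Params.Admissible.exists_neg_mul_le_R (hp : p.Admissible) :
    ∃ K : ℝ, 0 ≤ K ∧ ∀ z ∈ p.domain, ∀ i : Fin m, -(K * (1 + ‖z‖)) ≤ p.R z (Sum.inl i) := by
  choose K hK using fun i : Fin m => exists_neg_mul_le_levyKhintchine hp.truncation
    (hp.α_psd i) (p.β (Sum.inl i)) (hp.integrable_μ i)
  refine ⟨∑ i, |K i|, Finset.sum_nonneg fun _ _ => abs_nonneg _, fun z hz i => ?_⟩
  refine le_trans (neg_le_neg ?_) (hK i z ((Params.mem_domain_iff.1 hz).2 i))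
  gcongr
  exact (le_abs_self _).trans
    (Finset.single_le_sum (f := fun i => |K i|) (fun _ _ => abs_nonneg _) (Finset.mem_univ i))

theorem exists_norm_le_mul_of_abs_le (ι : Type*) [Fintype ι] :
    ∃ N : ℝ, 0 ≤ N ∧ ∀ (z : EuclideanSpace ℝ ι) (r : ℝ), 0 ≤ r → (∀ k, |z k| ≤ r) →
      ‖z‖ ≤ N * r := by
  refine ⟨Fintype.card ι, by positivity, fun z r hr h => ?_⟩
  rw [EuclideanSpace.norm_eq]
  refine Real.sqrt_le_iff.2 ⟨by positivity, ?_⟩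
  calc ∑ k, ‖z k‖ ^ 2 ≤ ∑ _k : ι, r ^ 2 := by
        gcongr with k
        exact h k
    _ = Fintype.card ι * r ^ 2 := by simp
    _ ≤ (Fintype.card ι : ℝ) ^ 2 * r ^ 2 := by
        gcongr
        exact_mod_cast Nat.le_self_pow two_ne_zero _
    _ = (Fintype.card ι * r) ^ 2 := by ring

/-! ### Construction of the solution below `Ψ` -/

/-- A solution of the equation for `Ψ` inside the interior of the domain extends to a solution
of the full system. -/
theorem Params.Admissible.exists_isSolution (hp : p.Admissible) {Λ y : Vec m n} {v T : ℝ}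
    (hT : 0 ≤ T) {w : ℝ → Vec m n} (hw0 : w 0 = y)
    (hw : ∀ s ∈ Set.Icc 0 T, w s ∈ interior p.domain)
    (hw' : ∀ s ∈ Set.Icc 0 T, HasDerivWithinAt w (p.R (w s) + v • Λ) (Set.Icc 0 T) s) :
    ∃ Φ, p.IsSolution Λ y v T Φ w := by
  have hcont : ContinuousOn (fun s => p.F (w s)) (Set.Icc 0 T) :=
    hp.continuousOn_F.comp (fun s hs => (hw' s hs).continuousWithinAt) hw
  -- The integrand is only known to be continuous on `[0, T]`. Its extension by constants makes the
  -- fundamental theorem of calculus available at the endpoints too.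
  set g := Set.IccExtend hT ((Set.Icc 0 T).domRestrict fun s => p.F (w s)) with hg
  have hgc : Continuous g := hcont.domRestrict.Icc_extend'
  refine ⟨fun s => ∫ r in (0 : ℝ)..s, g r, by simp, hw0, hw, fun s hs => ?_, hw'⟩
  have h := (hgc.integral_hasStrictDerivAt 0 s).hasDerivAt.hasDerivWithinAt (s := Set.Icc 0 T)
  rwa [hg, Set.IccExtend_of_mem hT _ hs] at h

theorem Params.Admissible.exists_isSolution_of_le (hp : p.Admissible) {Λ u y : Vec m n} {v T : ℝ}
    (hT : 0 ≤ T) {Φ : ℝ → ℝ} {Ψ : ℝ → Vec m n} (hΨ : p.IsSolution Λ u v T Φ Ψ)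
    (hI : ∀ i : Fin m, y (Sum.inl i) ≤ u (Sum.inl i))
    (hJ : ∀ j : Fin n, y (Sum.inr j) = u (Sum.inr j)) :
    ∃ Φ' Ψ', p.IsSolution Λ y v T Φ' Ψ' := by
  obtain ⟨B, hB⟩ := isCompact_Icc.exists_bound_of_continuousOn
    fun s hs => (hΨ.deriv_Ψ s hs).continuousWithinAt
  have hB0 : 0 ≤ B := (norm_nonneg _).trans (hB 0 ⟨le_rfl, hT⟩)
  obtain ⟨K, hK0, hK⟩ := hp.exists_neg_mul_le_R
  obtain ⟨N, hN0, hN⟩ := exists_norm_le_mul_of_abs_le (Fin m ⊕ Fin n)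
  -- `A` is at least `1` and dominates all coordinates of `y` and of `Ψ` on `[0, T]`. In the boxes
  -- `|z_k| ≤ E s`, hence `‖z‖ ≤ N * E s`. With `E s ≥ 1`, the choice of `κ` gives `K * (1 + ‖z‖) +
  -- ‖v • Λ‖ ≤ κ * E s`, so `-E` falls at least as fast as any solution in the box can.
  set A : ℝ := 1 + B + ‖y‖ with hA
  set κ : ℝ := K * (1 + N) + ‖v • Λ‖ with hκ
  have hκ0 : 0 ≤ κ := by positivity
  have hA1 : 1 ≤ A := by linarith [norm_nonneg y]
  set E : ℝ → ℝ := fun s => A * Real.exp (κ * s) with hE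
  have hAE : ∀ s, 0 ≤ s → A ≤ E s := fun s hs =>
    le_mul_of_one_le_right (by linarith) (Real.one_le_exp (by positivity))
  have hΨE : ∀ s ∈ Set.Icc 0 T, ∀ k, |Ψ s k| ≤ E s := fun s hs k => by
    have h1 := (PiLp.norm_apply_le (Ψ s) k).trans (hB s hs)
    rw [Real.norm_eq_abs] at h1
    linarith [hAE s hs.1, norm_nonneg y]
  -- The lower curve copies `Ψ` in the `J`-coordinates, which forces `z_J = Ψ_J` throughout the box.
  set a : ℝ → Vec m n := fun s =>
    WithLp.toLp 2 (Sum.elim (fun _ => -E s) fun j => Ψ s (Sum.inr j)) with ha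
  set a' : ℝ → Vec m n := fun s => WithLp.toLp 2 (Sum.elim (fun _ => -(κ * E s))
    fun j => (p.R (Ψ s) + v • Λ) (Sum.inr j)) with ha'
  have hJeq : ∀ s, ∀ z : Vec m n, (∀ i, a s i ≤ z i) → (∀ i, z i ≤ Ψ s i) →
      ∀ j, z (Sum.inr j) = Ψ s (Sum.inr j) := fun s z h1 h2 j =>
    le_antisymm (h2 _) (h1 (Sum.inr j))
  have hmem : ∀ s ∈ Set.Icc 0 T, ∀ z : Vec m n, (∀ i, a s i ≤ z i) → (∀ i, z i ≤ Ψ s i) →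
      z ∈ interior p.domain := fun s hs z h1 h2 =>
    hp.mem_interior_domain_of_le (hΨ.mem_interior s hs) (fun i => h2 _) (hJeq s z h1 h2)
  suffices hex : ∃ w : ℝ → Vec m n, w 0 = y ∧ ∀ s ∈ Set.Icc 0 T,
      (∀ i, a s i ≤ w s i) ∧ (∀ i, w s i ≤ Ψ s i) ∧
        HasDerivWithinAt w (p.R (w s) + v • Λ) (Set.Icc 0 T) s by
    obtain ⟨w, hw0, hw⟩ := hex
    obtain ⟨Φ', hΦ'⟩ := hp.exists_isSolution hT hw0
      (fun s hs => hmem s hs _ (hw s hs).1 (hw s hs).2.1) fun s hs => (hw s hs).2.2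
    exact ⟨Φ', w, hΦ'⟩
  refine exists_integralCurve_mem_box (V := fun z => p.R z + v • Λ) hT
    (U := interior p.domain) (a := a) (a' := a') (b := Ψ) (y := y) (fun i => ?_) (fun s hs => ?_)
    hΨ.deriv_Ψ (fun s hs i => ?_) hmem (fun s hs z h1 h2 i hi => ?_)
    (fun s hs z h1 h2 i hi => ?_) (fun i => ?_) (fun i => ?_)
  · intro x hx
    obtain ⟨C, t, ht, hC⟩ := hp.locallyLipschitzOn_R i hx
    refine ⟨C, t, ht, fun z hz z' hz' => ?_⟩
    simpa using hC hz hz'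
  · have hcoord : ∀ i, HasDerivWithinAt (fun s => (a s) i) (a' s i) (Set.Icc 0 T) s := by
      rintro (i | j)
      · have h := ((((hasDerivAt_id s).const_mul κ).exp.const_mul A).neg).hasDerivWithinAt
          (s := Set.Icc 0 T)
        refine h.congr_deriv ?_
        simp only [ha', hE, Sum.elim_inl, id_eq]
        ring
      · exact (EuclideanSpace.proj (𝕜 := ℝ) (Sum.inr j)).hasFDerivAt.comp_hasDerivWithinAt s
          (hΨ.deriv_Ψ s hs)
    exact (PiLp.hasFDerivAt_toLp 2 _).comp_hasDerivWithinAt s (hasDerivWithinAt_pi.2 hcoord)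
  · rcases i with i | j
    · exact (abs_le.1 (hΨE s hs _)).1
    · exact le_rfl
  · rcases i with i | j
    · have hE0 : 1 ≤ E s := hA1.trans (hAE s hs.1)
      have hz : ‖z‖ ≤ N * E s := by
        refine hN z _ (by linarith) fun k => abs_le.2 ⟨?_, (h2 k).trans (abs_le.1 (hΨE s hs k)).2⟩
        rcases k with k | k
        · exact h1 (Sum.inl k)
        · exact (abs_le.1 (hΨE s hs _)).1.trans (h1 (Sum.inr k))
      have hR := hK z (interior_subset (hmem s hs z h1 h2)) i
      have hΛ := (abs_le.1 (PiLp.norm_apply_le (v • Λ) (Sum.inl i))).1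
      have hKE : K * (1 + ‖z‖) ≤ K * ((1 + N) * E s) := by
        gcongr
        linarith
      have hΛE : ‖v • Λ‖ ≤ ‖v • Λ‖ * E s := le_mul_of_one_le_right (norm_nonneg _) hE0
      have hgoal : -(κ * E s) ≤ p.R z (Sum.inl i) + (v • Λ) (Sum.inl i) := by
        rw [hκ]
        linarith
      exact hgoal
    · have h := hp.R_inr_congr (hJeq s z h1 h2) j
      simp [ha', h]
  · rcases i with i | j
    · have h := hp.R_inl_le (interior_subset (hΨ.mem_interior s hs)) (fun i => h2 _)
        (hJeq s z h1 h2) hi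
      simpa using h
    · have h := hp.R_inr_congr (hJeq s z h1 h2) j
      simp [h]
  · rcases i with i | j
    · have h1 := (abs_le.1 (PiLp.norm_apply_le y (Sum.inl i))).1
      have h2 := hAE 0 le_rfl
      have h3 : -E 0 ≤ y (Sum.inl i) := by linarith
      exact h3
    · have h : Ψ 0 (Sum.inr j) ≤ y (Sum.inr j) := by rw [hΨ.init_Ψ, hJ]
      exact h
  · rw [hΨ.init_Ψ]
    rcases i with i | j
    · exact hI i
    · exact (hJ j).le

end AffineRiccati

theorem lemma2p4 (m n : ℕ) (p : AffineRiccati.Params m n) (hp : p.Admissible)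
    (Λ : AffineRiccati.Vec m n) (t : ℝ≥0)
    (u : AffineRiccati.Vec m n) (v : ℝ) (huv : (u, v) ∈ p.domainAt Λ t)
    (y : AffineRiccati.Vec m n) (z : ℝ)
    (hI : ∀ i : Fin m, y (Sum.inl i) ≤ u (Sum.inl i))
    (hJ : ∀ j : Fin n, y (Sum.inr j) = u (Sum.inr j))
    (hz : z = v) :
    (y, z) ∈ p.domainAt Λ t := by
  subst hz
  obtain ⟨hu, hlife⟩ := huv
  refine ⟨hp.mem_interior_domain_of_le hu hI hJ, ?_⟩
  -- A lifetime exceeding `t` means that a solution exists on some `[0, T]` with `T > t`. The same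
  -- `T` serves for `y`, so neither uniqueness nor a maximal solution is needed.
  simp only [AffineRiccati.Params.lifetime, lt_iSup_iff] at hlife ⊢
  obtain ⟨T, ⟨Φ, Ψ, hΨ⟩, htT⟩ := hlife
  exact ⟨T, hp.exists_isSolution_of_le T.2 hΨ hI hJ, htT⟩
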